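/- Let $d\ge 0$ be an integer, $\lambda>0$, and let $\log$ be the base-2 logarithm. Let $\mu_X\in\mathbb R^d$, $\mu_Y\in\mathbb R$, an invertible matrix $\Sigma\in\mathbb R^{d\times d}$, $\sigma_Y\in\mathbb R$ and $C\in\mathbb R^d$ be such that the set $\Gamma$ of all probability distributions $P$ of $(X,Y)$ on $\mathbb R^d\times\mathbb R$ with finite second moments and $$\mathbb E[X]=\mu_X,\quad \mathbb E[Y]=\mu_Y,\quad \mathrm{Var}[X]=\Sigma,\quad \mathrm{Var}[Y]=\sigma_Y^2,\quad \mathrm{Cov}[X,Y]=C$$ is nonempty. For a conditional distribution (Markov kernel) $P_{\hat Y|X}$ from $\mathbb R^d$ to $\mathbb R$ and $P\in\Gamma$, let $(X,Y)\sim P$, let $\hat Y$ have conditional law $P_{\hat Y|X}(\cdot\mid X)$ given $(X,Y)$, and define the risk-information cost $$\tilde L_\lambda(P_{\hat Y|X},P)=\mathbb E_P\big[(Y-\hat Y)^2\big]+\lambda I_P(X;\hat Y)\in[0,\infty],$$ where the mutual information $I_P$ is in bits. Let $\tilde L_\lambda^*=\inf_{P_{\hat Y|X}}\sup_{P\in\Gamma}\tilde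 L_\lambda(P_{\hat Y|X},P)$, the infimum being over all conditional distributions, and $s=C^T\Sigma^{-1}C$. Then $$\tilde L_\lambda^*=\begin{cases}\sigma_Y^2-s+\dfrac{\lambda}{2}\log\dfrac{2e\,s}{\lambda\log e}&\text{if }\frac{\lambda\log e}{2}<s,\\[2mm]\sigma_Y^2&\text{if }\frac{\lambda\log e}{2}\ge s.\end{cases}$$ Moreover, let $P^*_{\hat Y|X}$ be the conditional distribution of the estimate $$\hat Y=\begin{cases}a\,C^T\Sigma^{-1}X+b+Z&\text{if }\frac{\lambda\log e}{2}<s,\\ \mu_Y&\text{if }\frac{\lambda\log e}{2}\ge s,\end{cases}\qquad a=1-\frac{\lambda\log e}{2s},\quad b=\mu_Y-a\,C^T\Sigma^{-1}\mu_X,$$ where $Z\sim N(0,\sigma_Z^2)$ is independent of $X$ and $\sigma_Z^2=\frac{\lambda a\log e}{2}$. Then $P^*_{\hat Y|X}$ attains the infimum: $\sup_{P\in\Gamma}\tilde L_\lambda(P^*_{\hat Y|X},P)=\tilde L^*_\lambda$. There is a (possibly degenerate) Gaussian distribution $P^*\in\Gamma$, necessarily with the prescribed mean and covariance, which is a worst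 case: it maximizes $P\mapsto\inf_{P_{\hat Y|X}}\tilde L_\lambda(P_{\hat Y|X},P)$ over $\Gamma$, the maximal value is $\tilde L_\lambda^*$, and $P^*_{\hat Y|X}$ attains the infimum for $P=P^*$, i.e. $\tilde L_\lambda(P^*_{\hat Y|X},P^*)=\inf_{P_{\hat Y|X}}\tilde L_\lambda(P_{\hat Y|X},P^*)$. -/

import Mathlib

open MeasureTheory ProbabilityTheory InformationTheory Matrix
open scoped ENNReal

namespace RemotePrediction

noncomputable section

/-- Mutual information, in bits, of a pair of random variables with joint law `ρ`:
the relative entropy of the joint law with respect to the product of its marginals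
(`klDiv` is in nats). -/
def mutualInfo {α β : Type*} [MeasurableSpace α] [MeasurableSpace β] (ρ : Measure (α × β)) :
    ℝ≥0∞ :=
  klDiv ρ (ρ.fst.prod ρ.snd) / ENNReal.ofReal (Real.log 2)

/-- The risk `E_P[ℓ(Ŷ, Y)]` for a nonnegative loss `ℓ`, where `(X, Y) ∼ P` and, given
`(X, Y) = (x, y)`, the estimate `Ŷ` has law `κ x` (so that `Y → X → Ŷ` is a Markov chain). -/
def risk {𝓧 𝓨 𝓩 : Type*} [MeasurableSpace 𝓧] [MeasurableSpace 𝓨] [MeasurableSpace 𝓩]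
    (l : 𝓩 → 𝓨 → ℝ≥0∞) (κ : Kernel 𝓧 𝓩) (P : Measure (𝓧 × 𝓨)) : ℝ≥0∞ :=
  ∫⁻ q : (𝓧 × 𝓨) × 𝓩, l q.2 q.1.2 ∂(P ⊗ₘ κ.prodMkRight 𝓨)

/-- The risk-information cost `E_P[ℓ(Ŷ, Y)] + λ I_P(X; Ŷ)` of the estimator `P_{Ŷ|X} = κ`. -/
def riskInfoCost {𝓧 𝓨 𝓩 : Type*} [MeasurableSpace 𝓧] [MeasurableSpace 𝓨] [MeasurableSpace 𝓩]
    (l : 𝓩 → 𝓨 → ℝ≥0∞) (lam : ℝ) (κ : Kernel 𝓧 𝓩) (P : Measure (𝓧 × 𝓨)) : ℝ≥0∞ :=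
  risk l κ P + ENNReal.ofReal lam * mutualInfo (P.fst ⊗ₘ κ)

/-- The worst-case cost `sup_{P ∈ Γ}` of a fixed estimator. -/
def worstCaseCost {𝓧 𝓨 𝓩 : Type*} [MeasurableSpace 𝓧] [MeasurableSpace 𝓨] [MeasurableSpace 𝓩]
    (l : 𝓩 → 𝓨 → ℝ≥0∞) (lam : ℝ) (Γ : Set (Measure (𝓧 × 𝓨))) (κ : Kernel 𝓧 𝓩) : ℝ≥0∞ :=
  ⨆ P ∈ Γ, riskInfoCost l lam κ P

/-- The minimal cost `inf_{P_{Ŷ|X}}`, over all conditional distributions, for a fixed `P`. -/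
def minimalCost {𝓧 𝓨 𝓩 : Type*} [MeasurableSpace 𝓧] [MeasurableSpace 𝓨] [MeasurableSpace 𝓩]
    (l : 𝓩 → 𝓨 → ℝ≥0∞) (lam : ℝ) (P : Measure (𝓧 × 𝓨)) : ℝ≥0∞ :=
  ⨅ (κ : Kernel 𝓧 𝓩) (_ : IsMarkovKernel κ), riskInfoCost l lam κ P

/-- The minimax risk-information cost `inf_{P_{Ŷ|X}} sup_{P ∈ Γ}`, over all conditional
distributions. -/
def minimaxCost {𝓧 𝓨 𝓩 : Type*} [MeasurableSpace 𝓧] [MeasurableSpace 𝓨] [MeasurableSpace 𝓩]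
    (l : 𝓩 → 𝓨 → ℝ≥0∞) (lam : ℝ) (Γ : Set (Measure (𝓧 × 𝓨))) : ℝ≥0∞ :=
  ⨅ (κ : Kernel 𝓧 𝓩) (_ : IsMarkovKernel κ), worstCaseCost l lam Γ κ

/-- The squared loss. -/
def sqLoss (yhat y : ℝ) : ℝ≥0∞ := ENNReal.ofReal ((y - yhat) ^ 2)

/-- The set of all laws of `(X, Y)` on `ℝ^d × ℝ` with finite second moments and with
`E[X] = muX`, `E[Y] = muY`, `Var[X] = S`, `Var[Y] = σY ^ 2` and `Cov[X, Y] = C`. -/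
structure HasMoments {d : ℕ} (muX : Fin d → ℝ) (muY : ℝ) (S : Matrix (Fin d) (Fin d) ℝ)
    (σY : ℝ) (C : Fin d → ℝ) (P : Measure ((Fin d → ℝ) × ℝ)) : Prop where
  isProb : IsProbabilityMeasure P
  memLp_X : ∀ i, MemLp (fun p => p.1 i) 2 P
  memLp_Y : MemLp (fun p => p.2) 2 P
  mean_X : ∀ i, ∫ p, p.1 i ∂P = muX i
  mean_Y : ∫ p, p.2 ∂P = muY
  cov_X : ∀ i j, cov[fun p => p.1 i, fun p => p.1 j; P] = S i j
  var_Y : Var[fun p => p.2; P] = σY ^ 2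
  cov_XY : ∀ i, cov[fun p => p.1 i, fun p => p.2; P] = C i

/-- The ambiguity set: all laws with the given first and second moments. -/
def momentSet {d : ℕ} (muX : Fin d → ℝ) (muY : ℝ) (S : Matrix (Fin d) (Fin d) ℝ)
    (σY : ℝ) (C : Fin d → ℝ) : Set (Measure ((Fin d → ℝ) × ℝ)) :=
  {P | HasMoments muX muY S σY C P}

/-- The conditional law given `X` of `a wᵀX + b + Z`, where `Z ∼ N(0, v)` is independent of `X`. -/
def noisyLinearEstimate {d : ℕ} (a : ℝ) (w : Fin d → ℝ) (b v : ℝ) : Kernel (Fin d → ℝ) ℝ :=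
  (Kernel.id ×ₖ Kernel.const (Fin d → ℝ) (gaussianReal 0 v.toNNReal)).map
    (fun q => a * (w ⬝ᵥ q.1) + b + q.2)

/-- The constant estimate `c`. -/
def constEstimate {d : ℕ} (c : ℝ) : Kernel (Fin d → ℝ) ℝ :=
  Kernel.const (Fin d → ℝ) (Measure.dirac c)

end

end RemotePrediction

open RemotePrediction

/-!
The linear Gaussian estimate and a Gaussian law form a saddle point of the cost, so that the
minimax cost, the worst-case cost of the estimate and the minimal cost under the Gaussian law all
equal the value `V` of the cost at that point (`saddlePoint_values`). Write `w = S⁻¹ C`,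
`s = Cᵀ S⁻¹ C`, which is the variance of `wᵀX`, and `D = lam * log₂ e / 2`, so that a nat of
information costs `2 D`.

*Upper bound.* The squared risk of a linear estimate depends on the law only through its first two
moments, and so does a suitable bound on the information: by the chain rule for the relative
entropy, replacing the output law in the product of the marginals by any other law increases the
divergence (`klDiv_prod_snd_le`). With the Gaussian law that has the mean and variance of the
output, the expectation of the log-likelihood ratio is explicit
(`riskInfoCost_noisyLinearEstimate_le`). The constant estimate carries no information.

*Lower bound.* Let `P` be the law of `(X, wᵀX + c + ε)` with Gaussian `X` and independent Gaussian
noise `ε` of variance `σY² - s`. The squared risk of any estimate is `σY² - s` plus the mean squared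
distance `E` between the estimate and the regression function `wᵀX + c`
(`risk_gaussianLinearModel`). The information is bounded below by Gibbs' variational principle
(`ofReal_integral_le_klDiv`) with the test function `log (dN(z, D') / dN(muY, s))` evaluated at
`wᵀx + c`, where `D' = min D s`: its exponential integrates to one over the input for every output
`z`. The terms in `E` cancel, and `σY² - s + D' log (s / D') + D'` remains, which is `V`
(`le_riskInfoCost_gaussianLinearModel`). For `s = 0` the noise variance alone is `V`.
-/

/-! ### Bounds on relative entropy and mutual information -/

/-- Gibbs' variational lower bound: a function `f` whose exponential is a probability density
with respect to `ν` has `μ`-expectation at most `klDiv μ ν`. -/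
lemma ofReal_integral_le_klDiv {α : Type*} [MeasurableSpace α] {μ ν : Measure α}
    [IsProbabilityMeasure μ] [IsProbabilityMeasure ν] {f : α → ℝ} (hfm : Measurable f)
    (hf : Integrable f μ) (hexp : ∫⁻ x, ENNReal.ofReal (Real.exp (f x)) ∂ν = 1) :
    ENNReal.ofReal (∫ x, f x ∂μ) ≤ klDiv μ ν := by
  rcases eq_or_ne (klDiv μ ν) ∞ with h | h
  · simp [h]
  obtain ⟨hac, hint⟩ := klDiv_ne_top_iff.1 h
  have hexpi : Integrable (fun x => Real.exp (f x)) ν := by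
    refine ⟨by fun_prop, ?_⟩
    rw [hasFiniteIntegral_iff_ofReal (ae_of_all _ fun x => (Real.exp_pos _).le), hexp]
    exact ENNReal.one_lt_top
  have hone : ∫ x, Real.exp (f x) ∂ν = 1 := by
    rw [integral_eq_lintegral_of_nonneg_ae (ae_of_all _ fun x => (Real.exp_pos _).le)
      hexpi.aestronglyMeasurable, hexp, ENNReal.toReal_one]
  have := isProbabilityMeasure_tilted hexpi
  have key := integral_llr_add_sub_measure_univ_nonneg (μ := μ) (ν := ν.tilted f)
    (hac.trans (absolutelyContinuous_tilted hexpi)) (integrable_llr_tilted_right hac hf hint hexpi)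
  rw [integral_llr_tilted_right hac hf hexpi hint, hone, Real.log_one] at key
  rw [klDiv_of_ac_of_integrable hac hint]
  apply ENNReal.ofReal_le_ofReal
  simp only [probReal_univ] at key ⊢
  linarith

/-- The relative entropy of a measure with log-density `f` is the expectation of `f`. -/
lemma klDiv_withDensity_exp {α : Type*} [MeasurableSpace α] {μ ν : Measure α}
    [IsProbabilityMeasure μ] [IsProbabilityMeasure ν] {f : α → ℝ} (hfm : Measurable f)
    (hf : Integrable f μ)
    (hμ : μ = ν.withDensity fun x => ENNReal.ofReal (Real.exp (f x))) :
    klDiv μ ν = ENNReal.ofReal (∫ x, f x ∂μ) := by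
  have hac : μ ≪ ν := hμ ▸ withDensity_absolutelyContinuous _ _
  have hllr : llr μ ν =ᵐ[μ] f := by
    have h1 : μ.rnDeriv ν =ᵐ[ν] fun x => ENNReal.ofReal (Real.exp (f x)) := by
      conv_lhs => rw [hμ]
      exact Measure.rnDeriv_withDensity ν (by fun_prop)
    filter_upwards [hac.ae_le h1] with x hx
    rw [llr, hx, ENNReal.toReal_ofReal (Real.exp_pos _).le, Real.log_exp]
  rw [klDiv_of_ac_of_integrable hac ((integrable_congr hllr).2 hf), integral_congr_ae hllr]
  simp

/-- The marginal of the second coordinate is the best product approximation: replacing it by any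
other law increases the relative entropy. -/
lemma klDiv_prod_snd_le {α β : Type*} [MeasurableSpace α] [StandardBorelSpace α] [Nonempty α]
    [MeasurableSpace β] (ρ : Measure (α × β)) [IsProbabilityMeasure ρ]
    (σ : Measure β) [IsProbabilityMeasure σ] :
    klDiv ρ (ρ.fst.prod ρ.snd) ≤ klDiv ρ (ρ.fst.prod σ) := by
  have hρ : (ρ.snd ⊗ₘ (ρ.map Prod.swap).condKernel) = ρ.map Prod.swap := by
    rw [← Measure.fst_map_swap, Measure.disintegrate]
  have hswap : (ρ.map Prod.swap).map Prod.swap = ρ := by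
    rw [Measure.map_map measurable_swap measurable_swap]; simp
  -- By the chain rule the right-hand side exceeds the left-hand side by `klDiv ρ.snd σ`.
  have hchain := klDiv_compProd_eq_add ρ.snd σ (ρ.map Prod.swap).condKernel
    (Kernel.const β ρ.fst)
  rw [Measure.compProd_const, Measure.compProd_const, hρ] at hchain
  calc klDiv ρ (ρ.fst.prod ρ.snd)
      = klDiv ((ρ.map Prod.swap).map Prod.swap) ((ρ.snd.prod ρ.fst).map Prod.swap) := by
        rw [hswap, Measure.prod_swap]
    _ ≤ klDiv (ρ.map Prod.swap) (ρ.snd.prod ρ.fst) := klDiv_map_le _ _ measurable_swap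
    _ ≤ klDiv (ρ.map Prod.swap) (σ.prod ρ.fst) := hchain ▸ le_add_self
    _ = klDiv (ρ.map Prod.swap) ((ρ.fst.prod σ).map Prod.swap) := by rw [Measure.prod_swap]
    _ ≤ klDiv ρ (ρ.fst.prod σ) := klDiv_map_le _ _ measurable_swap

/-- The information cost in nats: converting bits to nats multiplies the weight by `log₂ e`. -/
lemma ofReal_mul_mutualInfo {α β : Type*} [MeasurableSpace α] [MeasurableSpace β]
    (ρ : Measure (α × β)) {lam : ℝ} (hlam : 0 < lam) :
    ENNReal.ofReal lam * mutualInfo ρ =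
      ENNReal.ofReal (lam * Real.logb 2 (Real.exp 1)) * klDiv ρ (ρ.fst.prod ρ.snd) := by
  have h2 : 0 < Real.log 2 := Real.log_pos one_lt_two
  rw [mutualInfo, Real.logb, Real.log_exp, ENNReal.ofReal_mul hlam.le,
    ENNReal.ofReal_div_of_pos h2, ENNReal.ofReal_one, div_eq_mul_inv, one_div, mul_assoc,
    mul_comm (klDiv _ _)]

/-! ### Gaussian laws on the line -/

/-- The logarithm of the density of `N(m₁, v₁)` with respect to `N(m₂, v₂)`, for positive
variances. -/
noncomputable def gaussianLogRatio (m₁ v₁ m₂ v₂ x : ℝ) : ℝ :=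
  1 / 2 * Real.log (v₂ / v₁) - (x - m₁) ^ 2 / (2 * v₁) + (x - m₂) ^ 2 / (2 * v₂)

lemma measurable_gaussianLogRatio {α : Type*} [MeasurableSpace α] {m₁ m₂ g : α → ℝ}
    (h₁ : Measurable m₁) (h₂ : Measurable m₂) (hg : Measurable g) (v₁ v₂ : ℝ) :
    Measurable fun x => gaussianLogRatio (m₁ x) v₁ (m₂ x) v₂ (g x) := by
  unfold gaussianLogRatio
  fun_prop

lemma gaussianPDFReal_mul_exp_gaussianLogRatio (m₁ m₂ x : ℝ) {v₁ v₂ : ℝ} (h₁ : 0 < v₁)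
    (h₂ : 0 < v₂) :
    gaussianPDFReal m₂ v₂.toNNReal x * Real.exp (gaussianLogRatio m₁ v₁ m₂ v₂ x) =
      gaussianPDFReal m₁ v₁.toNNReal x := by
  have hlog : Real.exp (1 / 2 * Real.log (v₂ / v₁)) = √v₂ / √v₁ := by
    rw [one_div, mul_comm, Real.exp_mul, Real.exp_log (by positivity), ← one_div,
      ← Real.sqrt_eq_rpow, Real.sqrt_div h₂.le]
  have hs₂ : √v₂ ≠ 0 := (Real.sqrt_pos.2 h₂).ne'
  have hs₁ : √v₁ ≠ 0 := (Real.sqrt_pos.2 h₁).ne'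
  have hpi : √(2 * Real.pi) ≠ 0 := (Real.sqrt_pos.2 (by positivity)).ne'
  rw [gaussianPDFReal, gaussianPDFReal, gaussianLogRatio, Real.coe_toNNReal _ h₁.le,
    Real.coe_toNNReal _ h₂.le, Real.exp_add, Real.exp_sub, hlog, Real.sqrt_mul (by positivity) v₁,
    Real.sqrt_mul (by positivity) v₂, neg_div, neg_div, Real.exp_neg, Real.exp_neg]
  field_simp

/-- `N(m₁, v₁)` has log-density `gaussianLogRatio m₁ v₁ m₂ v₂` with respect to `N(m₂, v₂)`. -/
lemma gaussianReal_eq_withDensity_gaussianReal (m₁ m₂ : ℝ) {v₁ v₂ : ℝ} (h₁ : 0 < v₁)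
    (h₂ : 0 < v₂) :
    gaussianReal m₁ v₁.toNNReal = (gaussianReal m₂ v₂.toNNReal).withDensity
      fun x => ENNReal.ofReal (Real.exp (gaussianLogRatio m₁ v₁ m₂ v₂ x)) := by
  have hm : Measurable fun x => ENNReal.ofReal (Real.exp (gaussianLogRatio m₁ v₁ m₂ v₂ x)) :=
    (measurable_gaussianLogRatio measurable_const measurable_const measurable_id _
      _).exp.ennreal_ofReal
  rw [gaussianReal_of_var_ne_zero _ (by simpa using h₁),
    gaussianReal_of_var_ne_zero _ (by simpa using h₂),
    ← withDensity_mul _ (measurable_gaussianPDF _ _) hm]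
  congr 1
  ext x
  rw [Pi.mul_apply, gaussianPDF, gaussianPDF, ← ENNReal.ofReal_mul (gaussianPDFReal_nonneg _ _ _),
    gaussianPDFReal_mul_exp_gaussianLogRatio _ _ _ h₁ h₂]

/-- For every reference mean, the likelihood ratio integrates to one. -/
lemma lintegral_exp_gaussianLogRatio (m₁ m₂ : ℝ) {v₁ v₂ : ℝ} (h₁ : 0 < v₁) (h₂ : 0 < v₂) :
    ∫⁻ x, ENNReal.ofReal (Real.exp (gaussianLogRatio m₁ v₁ m₂ v₂ x))
      ∂(gaussianReal m₂ v₂.toNNReal) = 1 := by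
  rw [← setLIntegral_univ, ← withDensity_apply _ MeasurableSet.univ,
    ← gaussianReal_eq_withDensity_gaussianReal m₁ m₂ h₁ h₂, measure_univ]

/-- The second moment about `c`, for a square-integrable random variable. -/
lemma lintegral_ofReal_sub_sq {Ω : Type*} [MeasurableSpace Ω] {μ : Measure Ω}
    [IsProbabilityMeasure μ] {X : Ω → ℝ} (hX : MemLp X 2 μ) (c : ℝ) :
    ∫⁻ ω, ENNReal.ofReal ((X ω - c) ^ 2) ∂μ = ENNReal.ofReal ((μ[X] - c) ^ 2 + Var[X; μ]) := by
  have hXi : Integrable X μ := hX.integrable one_le_two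
  have hc : MemLp (fun ω => X ω - c) 2 μ := hX.sub (memLp_const c)
  have hvar : Var[X; μ] = Var[fun ω => X ω - c; μ] :=
    (variance_sub_const hX.aestronglyMeasurable c).symm
  rw [← ofReal_integral_eq_lintegral_ofReal hc.integrable_sq (ae_of_all _ fun _ => sq_nonneg _),
    hvar, variance_eq_sub hc, integral_sub hXi (integrable_const _)]
  congr 1
  simp

lemma lintegral_ofReal_sub_sq_gaussianReal (m c : ℝ) {v : ℝ} (hv : 0 ≤ v) :
    ∫⁻ x, ENNReal.ofReal ((x - c) ^ 2) ∂(gaussianReal m v.toNNReal) =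
      ENNReal.ofReal ((m - c) ^ 2 + v) := by
  have h := lintegral_ofReal_sub_sq (memLp_id_gaussianReal (μ := m) (v := v.toNNReal) 2) c
  simpa [integral_id_gaussianReal, variance_id_gaussianReal, hv] using h

lemma integrable_of_lintegral_ofReal {Ω : Type*} [MeasurableSpace Ω] {μ : Measure Ω} {f : Ω → ℝ}
    (hf : Measurable f) (h0 : ∀ ω, 0 ≤ f ω) (h : ∫⁻ ω, ENNReal.ofReal (f ω) ∂μ ≠ ∞) :
    Integrable f μ :=
  ⟨hf.aestronglyMeasurable,
    (hasFiniteIntegral_iff_ofReal (ae_of_all _ h0)).2 (lt_top_iff_ne_top.2 h)⟩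

/-- The expected Gaussian log-likelihood ratio depends only on the two mean squared errors. -/
lemma integral_gaussianLogRatio {Ω : Type*} [MeasurableSpace Ω] {μ : Measure Ω}
    [IsProbabilityMeasure μ] {m₁ m₂ g : Ω → ℝ} (h₁ : Measurable m₁) (h₂ : Measurable m₂)
    (hg : Measurable g) (v₁ v₂ : ℝ) {e₁ e₂ : ℝ} (he₁ : 0 ≤ e₁) (he₂ : 0 ≤ e₂)
    (hE₁ : ∫⁻ ω, ENNReal.ofReal ((g ω - m₁ ω) ^ 2) ∂μ = ENNReal.ofReal e₁)
    (hE₂ : ∫⁻ ω, ENNReal.ofReal ((g ω - m₂ ω) ^ 2) ∂μ = ENNReal.ofReal e₂) :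
    Integrable (fun ω => gaussianLogRatio (m₁ ω) v₁ (m₂ ω) v₂ (g ω)) μ ∧
    ∫ ω, gaussianLogRatio (m₁ ω) v₁ (m₂ ω) v₂ (g ω) ∂μ =
      1 / 2 * Real.log (v₂ / v₁) - e₁ / (2 * v₁) + e₂ / (2 * v₂) := by
  have hi₁ : Integrable (fun ω => (g ω - m₁ ω) ^ 2) μ :=
    integrable_of_lintegral_ofReal (by fun_prop) (fun _ => sq_nonneg _)
      (hE₁ ▸ ENNReal.ofReal_ne_top)
  have hi₂ : Integrable (fun ω => (g ω - m₂ ω) ^ 2) μ :=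
    integrable_of_lintegral_ofReal (by fun_prop) (fun _ => sq_nonneg _)
      (hE₂ ▸ ENNReal.ofReal_ne_top)
  have hI₁ : ∫ ω, (g ω - m₁ ω) ^ 2 ∂μ = e₁ := by
    rw [integral_eq_lintegral_of_nonneg_ae (ae_of_all _ fun _ => sq_nonneg _)
      hi₁.aestronglyMeasurable, hE₁, ENNReal.toReal_ofReal he₁]
  have hI₂ : ∫ ω, (g ω - m₂ ω) ^ 2 ∂μ = e₂ := by
    rw [integral_eq_lintegral_of_nonneg_ae (ae_of_all _ fun _ => sq_nonneg _)
      hi₂.aestronglyMeasurable, hE₂, ENNReal.toReal_ofReal he₂]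
  have hd₁ := hi₁.div_const (2 * v₁)
  have hd₂ := hi₂.div_const (2 * v₂)
  have hc : Integrable (fun _ : Ω => 1 / 2 * Real.log (v₂ / v₁)) μ := integrable_const _
  have hcd : Integrable (fun ω => 1 / 2 * Real.log (v₂ / v₁) - (g ω - m₁ ω) ^ 2 / (2 * v₁)) μ :=
    hc.sub hd₁
  refine ⟨hcd.add hd₂, ?_⟩
  unfold gaussianLogRatio
  rw [integral_add hcd hd₂, integral_sub hc hd₁, integral_div, integral_div, hI₁, hI₂]
  simp

/-! ### Moments of linear functionals -/

@[fun_prop]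
lemma measurable_dotProduct_right {d : ℕ} (w : Fin d → ℝ) :
    Measurable fun x : Fin d → ℝ => w ⬝ᵥ x := by
  simp only [dotProduct]; fun_prop

section LinearFunctional

variable {Ω : Type*} [MeasurableSpace Ω] {μ : Measure Ω} {d : ℕ}
  {X : Ω → Fin d → ℝ}

lemma memLp_dotProduct (hX : ∀ i, MemLp (fun ω => X ω i) 2 μ) (u : Fin d → ℝ) :
    MemLp (fun ω => u ⬝ᵥ X ω) 2 μ :=
  memLp_finsetSum _ fun i _ => (hX i).const_mul (u i)

lemma integral_dotProduct [IsProbabilityMeasure μ] (hX : ∀ i, MemLp (fun ω => X ω i) 2 μ)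
    {m : Fin d → ℝ} (hm : ∀ i, ∫ ω, X ω i ∂μ = m i) (u : Fin d → ℝ) :
    ∫ ω, u ⬝ᵥ X ω ∂μ = u ⬝ᵥ m := by
  simp only [dotProduct]
  rw [integral_finsetSum _ fun i _ => ((hX i).integrable one_le_two).const_mul (u i)]
  simp [integral_const_mul, hm]

lemma covariance_dotProduct_left [IsProbabilityMeasure μ]
    (hX : ∀ i, MemLp (fun ω => X ω i) 2 μ) {Y : Ω → ℝ} (hY : MemLp Y 2 μ) {C : Fin d → ℝ}
    (hC : ∀ i, cov[fun ω => X ω i, Y; μ] = C i) (u : Fin d → ℝ) :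
    cov[fun ω => u ⬝ᵥ X ω, Y; μ] = u ⬝ᵥ C := by
  simp only [dotProduct]
  rw [covariance_fun_sum_left (fun i => (hX i).const_mul (u i)) hY]
  simp [covariance_const_mul_left, hC]

lemma variance_dotProduct [IsProbabilityMeasure μ]
    (hX : ∀ i, MemLp (fun ω => X ω i) 2 μ) {S : Matrix (Fin d) (Fin d) ℝ}
    (hS : ∀ i j, cov[fun ω => X ω i, fun ω => X ω j; μ] = S i j) (u : Fin d → ℝ) :
    Var[fun ω => u ⬝ᵥ X ω; μ] = u ⬝ᵥ S *ᵥ u := by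
  have hu := memLp_dotProduct hX u
  rw [← covariance_self hu.aemeasurable]
  refine covariance_dotProduct_left hX hu (fun i => ?_) u
  rw [covariance_comm, covariance_dotProduct_left hX (hX i) (C := fun j => S i j), dotProduct_comm]
  · rfl
  · intro j
    rw [covariance_comm, hS]

end LinearFunctional

section MomentSet

variable {d : ℕ} {muX : Fin d → ℝ} {muY : ℝ} {S : Matrix (Fin d) (Fin d) ℝ} {σY : ℝ}
  {C : Fin d → ℝ} {P : Measure ((Fin d → ℝ) × ℝ)}

lemma posSemidef_of_hasMoments (hP : HasMoments muX muY S σY C P) : S.PosSemidef := by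
  have := hP.isProb
  refine PosSemidef.of_dotProduct_mulVec_nonneg ?_ fun u => ?_
  · ext i j
    simp [← hP.cov_X, covariance_comm]
  · rw [star_trivial, ← variance_dotProduct hP.memLp_X hP.cov_X]
    exact variance_nonneg _ _

/-- The coefficient vector `w = S⁻¹ C` of the best linear predictor of `Y` from `X` satisfies
`Cov[wᵀX, Y] = Cᵀ S⁻¹ C`. -/
lemma regression_dotProduct (S : Matrix (Fin d) (Fin d) ℝ) (C : Fin d → ℝ) :
    (C ᵥ* S⁻¹) ⬝ᵥ C = C ⬝ᵥ (S⁻¹ *ᵥ C) :=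
  (dotProduct_mulVec _ _ _).symm

/-- The best linear predictor has variance `Cᵀ S⁻¹ C`. -/
lemma regression_quadratic (hS : IsUnit S.det) (C : Fin d → ℝ) :
    (C ᵥ* S⁻¹) ⬝ᵥ S *ᵥ (C ᵥ* S⁻¹) = C ⬝ᵥ (S⁻¹ *ᵥ C) := by
  rw [dotProduct_mulVec, vecMul_vecMul, nonsing_inv_mul _ hS, vecMul_one, dotProduct_comm,
    regression_dotProduct]

/-- The first two moments of the prediction error `a wᵀX + b - Y` of a scaled linear predictor. -/
lemma variance_linear_sub (hS : IsUnit S.det) (hP : HasMoments muX muY S σY C P) (a b : ℝ) :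
    MemLp (fun p => a * ((C ᵥ* S⁻¹) ⬝ᵥ p.1) + b - p.2) 2 P ∧
    ∫ p, a * ((C ᵥ* S⁻¹) ⬝ᵥ p.1) + b - p.2 ∂P = a * ((C ᵥ* S⁻¹) ⬝ᵥ muX) + b - muY ∧
    Var[fun p => a * ((C ᵥ* S⁻¹) ⬝ᵥ p.1) + b - p.2; P] =
      a ^ 2 * (C ⬝ᵥ (S⁻¹ *ᵥ C)) - 2 * a * (C ⬝ᵥ (S⁻¹ *ᵥ C)) + σY ^ 2 := by
  have := hP.isProb
  have hw : MemLp (fun p : (Fin d → ℝ) × ℝ => (C ᵥ* S⁻¹) ⬝ᵥ p.1) 2 P :=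
    memLp_dotProduct hP.memLp_X _
  have haw : MemLp (fun p : (Fin d → ℝ) × ℝ => a * ((C ᵥ* S⁻¹) ⬝ᵥ p.1)) 2 P := hw.const_mul a
  have hab : MemLp (fun p : (Fin d → ℝ) × ℝ => a * ((C ᵥ* S⁻¹) ⬝ᵥ p.1) + b) 2 P :=
    haw.add (memLp_const b)
  refine ⟨hab.sub hP.memLp_Y, ?_, ?_⟩
  · rw [integral_sub (hab.integrable one_le_two) (hP.memLp_Y.integrable one_le_two),
      integral_add (haw.integrable one_le_two) (integrable_const b), integral_const_mul,
      integral_dotProduct hP.memLp_X hP.mean_X, hP.mean_Y]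
    simp
  · rw [variance_fun_sub hab hP.memLp_Y, variance_add_const haw.aestronglyMeasurable,
      variance_const_mul, covariance_add_const_left (haw.integrable one_le_two),
      covariance_const_mul_left, covariance_dotProduct_left hP.memLp_X hP.memLp_Y hP.cov_XY,
      variance_dotProduct hP.memLp_X hP.cov_X, hP.var_Y, regression_dotProduct,
      regression_quadratic hS]
    ring

lemma regression_nonneg (hS : IsUnit S.det) (hP : HasMoments muX muY S σY C P) :
    0 ≤ C ⬝ᵥ (S⁻¹ *ᵥ C) := by
  have := hP.isProb
  rw [← regression_quadratic hS, ← variance_dotProduct hP.memLp_X hP.cov_X]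
  exact variance_nonneg _ _

/-- The variance explained by the best linear predictor is at most the total variance. -/
lemma regression_le (hS : IsUnit S.det) (hP : HasMoments muX muY S σY C P) :
    C ⬝ᵥ (S⁻¹ *ᵥ C) ≤ σY ^ 2 := by
  have h := (variance_linear_sub hS hP 1 0).2.2
  have h0 := variance_nonneg (fun p => 1 * ((C ᵥ* S⁻¹) ⬝ᵥ p.1) + 0 - p.2) P
  linarith

end MomentSet

/-! ### The cost of the linear Gaussian and of the constant estimate -/

/-- Since the estimate is drawn from `κ x` given `(X, Y) = (x, y)`, the squared risk is an
iterated integral. -/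
lemma risk_sqLoss_eq {𝓧 : Type*} [MeasurableSpace 𝓧] (κ : Kernel 𝓧 ℝ) [IsMarkovKernel κ]
    (P : Measure (𝓧 × ℝ)) [SFinite P] :
    risk sqLoss κ P = ∫⁻ p, ∫⁻ z, ENNReal.ofReal ((p.2 - z) ^ 2) ∂(κ p.1) ∂P := by
  unfold risk sqLoss
  rw [Measure.lintegral_compProd (by fun_prop)]
  simp [Kernel.prodMkRight_apply]

instance isMarkovKernel_noisyLinearEstimate {d : ℕ} (a : ℝ) (w : Fin d → ℝ) (b v : ℝ) :
    IsMarkovKernel (noisyLinearEstimate a w b v) := by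
  unfold noisyLinearEstimate
  exact Kernel.IsMarkovKernel.map _ (by fun_prop)

instance isMarkovKernel_constEstimate {d : ℕ} (c : ℝ) :
    IsMarkovKernel (constEstimate (d := d) c) := by
  unfold constEstimate
  infer_instance

lemma noisyLinearEstimate_apply {d : ℕ} (a : ℝ) (w : Fin d → ℝ) (b v : ℝ) (x : Fin d → ℝ) :
    noisyLinearEstimate a w b v x = gaussianReal (a * (w ⬝ᵥ x) + b) v.toNNReal := by
  have hm : Measurable fun q : (Fin d → ℝ) × ℝ => a * (w ⬝ᵥ q.1) + b + q.2 := by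
    fun_prop
  rw [noisyLinearEstimate, Kernel.map_apply _ hm, Kernel.prod_apply, Kernel.id_apply,
    Kernel.const_apply, Measure.dirac_prod, Measure.map_map hm (by fun_prop)]
  have := gaussianReal_map_const_add (μ := 0) (v := v.toNNReal) (a * (w ⬝ᵥ x) + b)
  rw [zero_add] at this
  rw [← this]
  rfl

/-- The relative entropy of the input-output law of a linear Gaussian estimate with respect to the
product of the input law and any Gaussian law. When the latter is the best Gaussian fit to the
output, in that `τ` is the second moment of the output about `m`, only the logarithm remains. -/
lemma klDiv_noisyLinearEstimate {d : ℕ} (π : Measure (Fin d → ℝ)) [IsProbabilityMeasure π]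
    (a : ℝ) (w : Fin d → ℝ) (b m : ℝ) {v τ : ℝ} (hv : 0 < v) (hτ : 0 < τ)
    (hE : ∫⁻ x, ENNReal.ofReal ((a * (w ⬝ᵥ x) + b - m) ^ 2 + v) ∂π = ENNReal.ofReal τ) :
    klDiv (π ⊗ₘ noisyLinearEstimate a w b v) (π.prod (gaussianReal m τ.toNNReal)) =
      ENNReal.ofReal (1 / 2 * Real.log (τ / v)) := by
  set κ := noisyLinearEstimate a w b v with hκ
  set f : (Fin d → ℝ) × ℝ → ℝ := fun p => gaussianLogRatio (a * (w ⬝ᵥ p.1) + b) v m τ p.2 with hf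
  have hmean : Measurable fun p : (Fin d → ℝ) × ℝ => a * (w ⬝ᵥ p.1) + b := by
    fun_prop
  have hfm : Measurable f :=
    measurable_gaussianLogRatio hmean measurable_const measurable_snd _ _
  set g : (Fin d → ℝ) → ℝ → ℝ≥0∞ := fun x z => ENNReal.ofReal (Real.exp (f (x, z))) with hg
  have hgm : Measurable (Function.uncurry g) := hfm.exp.ennreal_ofReal
  have hκd : κ = (Kernel.const _ (gaussianReal m τ.toNNReal)).withDensity g := by
    ext1 x
    rw [Kernel.withDensity_apply _ hgm, Kernel.const_apply, hκ, noisyLinearEstimate_apply,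
      gaussianReal_eq_withDensity_gaussianReal _ m hv hτ]
  have hdens : π ⊗ₘ κ = (π.prod (gaussianReal m τ.toNNReal)).withDensity
      fun p => ENNReal.ofReal (Real.exp (f p)) := by
    have : IsSFiniteKernel ((Kernel.const (Fin d → ℝ) (gaussianReal m τ.toNNReal)).withDensity g) :=
      hκd ▸ inferInstance
    rw [← Measure.compProd_const, hκd, Measure.compProd_withDensity hgm]
  have hE₁ : ∫⁻ p, ENNReal.ofReal ((p.2 - (a * (w ⬝ᵥ p.1) + b)) ^ 2) ∂(π ⊗ₘ κ) =
      ENNReal.ofReal v := by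
    rw [Measure.lintegral_compProd (by fun_prop)]
    simp [hκ, noisyLinearEstimate_apply, lintegral_ofReal_sub_sq_gaussianReal _ _ hv.le]
  have hE₂ : ∫⁻ p, ENNReal.ofReal ((p.2 - m) ^ 2) ∂(π ⊗ₘ κ) = ENNReal.ofReal τ := by
    rw [Measure.lintegral_compProd (by fun_prop), ← hE]
    simp [hκ, noisyLinearEstimate_apply, lintegral_ofReal_sub_sq_gaussianReal _ _ hv.le]
  obtain ⟨hint, hval⟩ := integral_gaussianLogRatio hmean measurable_const measurable_snd v τ hv.le
    hτ.le hE₁ hE₂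
  rw [klDiv_withDensity_exp hfm hint hdens, hval]
  congr 1
  field_simp
  ring

section MomentSet

variable {d : ℕ} {muX : Fin d → ℝ} {muY : ℝ} {S : Matrix (Fin d) (Fin d) ℝ} {σY : ℝ}
  {C : Fin d → ℝ} {P : Measure ((Fin d → ℝ) × ℝ)}

lemma risk_noisyLinearEstimate (hS : IsUnit S.det) (hP : HasMoments muX muY S σY C P)
    (a : ℝ) {v : ℝ} (hv : 0 ≤ v) :
    risk sqLoss (noisyLinearEstimate a (C ᵥ* S⁻¹) (muY - a * (C ᵥ* S⁻¹ ⬝ᵥ muX)) v) P =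
      ENNReal.ofReal
        (a ^ 2 * (C ⬝ᵥ (S⁻¹ *ᵥ C)) - 2 * a * (C ⬝ᵥ (S⁻¹ *ᵥ C)) + σY ^ 2 + v) := by
  have := hP.isProb
  set b := muY - a * (C ᵥ* S⁻¹ ⬝ᵥ muX) with hb
  obtain ⟨hL, hmean, hvar⟩ := variance_linear_sub hS hP a b
  rw [risk_sqLoss_eq]
  have hinner : ∀ p : (Fin d → ℝ) × ℝ,
      ∫⁻ z, ENNReal.ofReal ((p.2 - z) ^ 2) ∂(noisyLinearEstimate a (C ᵥ* S⁻¹) b v p.1) =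
        ENNReal.ofReal ((a * ((C ᵥ* S⁻¹) ⬝ᵥ p.1) + b - p.2 - 0) ^ 2) + ENNReal.ofReal v := by
    intro p
    simp_rw [sub_sq_comm p.2]
    rw [noisyLinearEstimate_apply, lintegral_ofReal_sub_sq_gaussianReal _ _ hv,
      ENNReal.ofReal_add (sq_nonneg _) hv, sub_zero]
  simp_rw [hinner]
  rw [lintegral_add_right _ measurable_const, lintegral_ofReal_sub_sq hL, hmean, hvar,
    lintegral_const, measure_univ, mul_one, ← ENNReal.ofReal_add _ hv]
  · congr 1
    rw [hb]
    ring
  · rw [← hvar]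
    exact add_nonneg (sq_nonneg _) (variance_nonneg _ _)

/-- The second moment about `muY` of the output of the linear Gaussian estimate. -/
lemma lintegral_fst_linear (hS : IsUnit S.det) (hP : HasMoments muX muY S σY C P)
    (a : ℝ) {v : ℝ} (hv : 0 ≤ v) :
    ∫⁻ x, ENNReal.ofReal ((a * ((C ᵥ* S⁻¹) ⬝ᵥ x) + (muY - a * (C ᵥ* S⁻¹ ⬝ᵥ muX)) - muY) ^ 2 + v)
      ∂P.fst = ENNReal.ofReal (a ^ 2 * (C ⬝ᵥ (S⁻¹ *ᵥ C)) + v) := by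
  have := hP.isProb
  have hw : MemLp (fun p : (Fin d → ℝ) × ℝ => a * ((C ᵥ* S⁻¹) ⬝ᵥ p.1)) 2 P :=
    (memLp_dotProduct hP.memLp_X _).const_mul a
  rw [Measure.fst, lintegral_map (by fun_prop) measurable_fst]
  have hinner : ∀ p : (Fin d → ℝ) × ℝ,
      ENNReal.ofReal ((a * ((C ᵥ* S⁻¹) ⬝ᵥ p.1) + (muY - a * (C ᵥ* S⁻¹ ⬝ᵥ muX)) - muY) ^ 2 + v) =
      ENNReal.ofReal ((a * ((C ᵥ* S⁻¹) ⬝ᵥ p.1) - a * (C ᵥ* S⁻¹ ⬝ᵥ muX)) ^ 2) +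
        ENNReal.ofReal v := by
    intro p
    rw [← ENNReal.ofReal_add (sq_nonneg _) hv]
    congr 2
    ring
  simp_rw [hinner]
  have hsq : 0 ≤ a ^ 2 * (C ⬝ᵥ (S⁻¹ *ᵥ C)) :=
    mul_nonneg (sq_nonneg _) (regression_nonneg hS hP)
  rw [lintegral_add_right _ measurable_const, lintegral_ofReal_sub_sq hw, integral_const_mul,
    integral_dotProduct hP.memLp_X hP.mean_X, variance_const_mul,
    variance_dotProduct hP.memLp_X hP.cov_X, regression_quadratic hS, sub_self,
    zero_pow two_ne_zero, zero_add, lintegral_const, measure_univ, mul_one,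
    ← ENNReal.ofReal_add hsq hv]

/-- The cost of a linear Gaussian estimate is bounded uniformly over the moment set, because the
input-output law is compared to a product law that depends on the moments only. -/
lemma riskInfoCost_noisyLinearEstimate_le (hS : IsUnit S.det)
    (hP : HasMoments muX muY S σY C P) {lam : ℝ} (hlam : 0 < lam) (a : ℝ) {v : ℝ} (hv : 0 < v) :
    riskInfoCost sqLoss lam
        (noisyLinearEstimate a (C ᵥ* S⁻¹) (muY - a * (C ᵥ* S⁻¹ ⬝ᵥ muX)) v) P ≤
      ENNReal.ofReal
        (a ^ 2 * (C ⬝ᵥ (S⁻¹ *ᵥ C)) - 2 * a * (C ⬝ᵥ (S⁻¹ *ᵥ C)) + σY ^ 2 + v) +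
      ENNReal.ofReal (lam * Real.logb 2 (Real.exp 1)) *
        ENNReal.ofReal (1 / 2 * Real.log ((a ^ 2 * (C ⬝ᵥ (S⁻¹ *ᵥ C)) + v) / v)) := by
  have := hP.isProb
  have hτ : 0 < a ^ 2 * (C ⬝ᵥ (S⁻¹ *ᵥ C)) + v :=
    add_pos_of_nonneg_of_pos (mul_nonneg (sq_nonneg _) (regression_nonneg hS hP)) hv
  rw [riskInfoCost, ofReal_mul_mutualInfo _ hlam, risk_noisyLinearEstimate hS hP a hv.le]
  gcongr
  refine (klDiv_prod_snd_le _
    (gaussianReal muY (a ^ 2 * (C ⬝ᵥ (S⁻¹ *ᵥ C)) + v).toNNReal)).trans_eq ?_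
  rw [Measure.fst_compProd]
  exact klDiv_noisyLinearEstimate _ _ _ _ _ hv hτ (lintegral_fst_linear hS hP a hv.le)

lemma riskInfoCost_constEstimate (hP : HasMoments muX muY S σY C P) (lam : ℝ) :
    riskInfoCost sqLoss lam (constEstimate muY) P = ENNReal.ofReal (σY ^ 2) := by
  have := hP.isProb
  have hinfo : mutualInfo (P.fst ⊗ₘ constEstimate muY) = 0 := by
    rw [mutualInfo, constEstimate, Measure.compProd_const, Measure.fst_prod, Measure.snd_prod,
      klDiv_self, ENNReal.zero_div]
  rw [riskInfoCost, hinfo, mul_zero, add_zero, risk_sqLoss_eq]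
  have h := lintegral_ofReal_sub_sq hP.memLp_Y muY
  rw [hP.mean_Y, hP.var_Y, sub_self, zero_pow two_ne_zero, zero_add] at h
  rw [← h]
  refine lintegral_congr fun p => ?_
  rw [constEstimate, Kernel.const_apply, lintegral_dirac' _ (by fun_prop)]

end MomentSet

/-! ### The worst-case Gaussian law -/

/-- The Gaussian law with mean `m` and covariance matrix `S` on `Fin d → ℝ` (with its sup norm,
while `multivariateGaussian` lives on the Euclidean space). -/
noncomputable def gaussianVector {d : ℕ} (m : Fin d → ℝ) (S : Matrix (Fin d) (Fin d) ℝ) :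
    Measure (Fin d → ℝ) :=
  (multivariateGaussian (WithLp.toLp 2 m) S).map (EuclideanSpace.equiv (Fin d) ℝ)

lemma aestronglyMeasurable_coord {d : ℕ} {μ : Measure (Fin d → ℝ)} (i : Fin d) :
    AEStronglyMeasurable (fun x : Fin d → ℝ => x i) μ :=
  (measurable_pi_apply i).aestronglyMeasurable

section GaussianVector

variable {d : ℕ} (m : Fin d → ℝ) {S : Matrix (Fin d) (Fin d) ℝ}

instance isGaussian_gaussianVector (S : Matrix (Fin d) (Fin d) ℝ) :
    IsGaussian (gaussianVector m S) := by
  unfold gaussianVector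
  infer_instance

lemma memLp_gaussianVector (S : Matrix (Fin d) (Fin d) ℝ) (i : Fin d) :
    MemLp (fun x : Fin d → ℝ => x i) 2 (gaussianVector m S) :=
  IsGaussian.memLp_dual _ (ContinuousLinearMap.proj i : (Fin d → ℝ) →L[ℝ] ℝ) 2 (by simp)

lemma integral_gaussianVector (S : Matrix (Fin d) (Fin d) ℝ) (i : Fin d) :
    ∫ x, x i ∂(gaussianVector m S) = m i := by
  unfold gaussianVector
  rw [integral_map (by fun_prop) (aestronglyMeasurable_coord i)]
  have h := ContinuousLinearMap.integral_comp_comm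
    (EuclideanSpace.proj i : EuclideanSpace ℝ (Fin d) →L[ℝ] ℝ)
    (IsGaussian.integrable_id (μ := multivariateGaussian (WithLp.toLp 2 m) S))
  simp only [id] at h
  rw [integral_id_multivariateGaussian] at h
  exact h

lemma covariance_gaussianVector (hS : S.PosSemidef) (i j : Fin d) :
    cov[fun x => x i, fun x => x j; gaussianVector m S] = S i j := by
  unfold gaussianVector
  rw [covariance_map_fun (aestronglyMeasurable_coord i)
    (aestronglyMeasurable_coord j) (by fun_prop)]
  exact covariance_eval_multivariateGaussian hS i j

/-- An affine functional of a Gaussian vector is Gaussian. -/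
lemma map_gaussianVector_affine (hS : S.PosSemidef) (w : Fin d → ℝ) (c : ℝ) :
    (gaussianVector m S).map (fun x => w ⬝ᵥ x + c) =
      gaussianReal (w ⬝ᵥ m + c) (w ⬝ᵥ S *ᵥ w).toNNReal := by
  have hL : IsGaussian ((gaussianVector m S).map fun x => w ⬝ᵥ x) := by
    have h : (fun x => w ⬝ᵥ x) =
        ⇑(∑ i, w i • (ContinuousLinearMap.proj i : (Fin d → ℝ) →L[ℝ] ℝ)) := by
      ext x
      simp [dotProduct]
    rw [h]
    infer_instance
  have hG := IsGaussian.eq_gaussianReal _ hL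
  rw [integral_map (by fun_prop) (by fun_prop), variance_id_map (by fun_prop)] at hG
  simp only [id] at hG
  rw [integral_dotProduct (memLp_gaussianVector m S) (integral_gaussianVector m S),
    variance_dotProduct (memLp_gaussianVector m S) (covariance_gaussianVector m hS)] at hG
  rw [← gaussianReal_map_add_const, ← hG, Measure.map_map (by fun_prop) (by fun_prop)]
  rfl

end GaussianVector

/-- The law of `(X, wᵀX + c + ε)` with `X ∼ N(m, S)` and independent `ε ∼ N(0, v)`. -/
noncomputable def gaussianLinearModel {d : ℕ} (m : Fin d → ℝ) (S : Matrix (Fin d) (Fin d) ℝ)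
    (w : Fin d → ℝ) (c v : ℝ) : Measure ((Fin d → ℝ) × ℝ) :=
  ((gaussianVector m S).prod (gaussianReal 0 v.toNNReal)).map
    fun q => (q.1, w ⬝ᵥ q.1 + c + q.2)

section GaussianLinearModel

variable {d : ℕ} (m : Fin d → ℝ) (S : Matrix (Fin d) (Fin d) ℝ) (w : Fin d → ℝ) (c v : ℝ)

lemma measurable_linearModel :
    Measurable fun q : (Fin d → ℝ) × ℝ => (q.1, w ⬝ᵥ q.1 + c + q.2) := by
  fun_prop

instance isGaussian_gaussianLinearModel : IsGaussian (gaussianLinearModel m S w c v) := by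
  let L : ((Fin d → ℝ) × ℝ) →L[ℝ] ((Fin d → ℝ) × ℝ) :=
    (ContinuousLinearMap.fst ℝ _ _).prod
      ((∑ i, w i • (ContinuousLinearMap.proj i : (Fin d → ℝ) →L[ℝ] ℝ)).comp
        (ContinuousLinearMap.fst ℝ _ _) + ContinuousLinearMap.snd ℝ _ _)
  have h : gaussianLinearModel m S w c v =
      (((gaussianVector m S).prod (gaussianReal 0 v.toNNReal)).map L).map
        (fun q => q + ((0 : Fin d → ℝ), c)) := by
    rw [Measure.map_map (by fun_prop) (by fun_prop), gaussianLinearModel]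
    congr 1
    ext q
    · simp [L]
    · simp [L, dotProduct]
      ring
  rw [h]
  infer_instance

lemma fst_gaussianLinearModel : (gaussianLinearModel m S w c v).fst = gaussianVector m S := by
  rw [gaussianLinearModel, Measure.fst, Measure.map_map measurable_fst
    (measurable_linearModel w c)]
  exact Measure.fst_prod

/-- The moments of the Gaussian linear model. -/
lemma hasMoments_gaussianLinearModel (hS : S.PosSemidef) (hv : 0 ≤ v) {muY σY : ℝ}
    {C : Fin d → ℝ} (hmean : w ⬝ᵥ m + c = muY) (hvar : w ⬝ᵥ S *ᵥ w + v = σY ^ 2)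
    (hC : S *ᵥ w = C) : HasMoments m muY S σY C (gaussianLinearModel m S w c v) := by
  set π := gaussianVector m S with hπ
  set N := gaussianReal 0 v.toNNReal with hN
  have hT := measurable_linearModel w c
  have hLp := memLp_gaussianVector m S
  have hcov := covariance_gaussianVector m hS
  have hw : MemLp (fun x => w ⬝ᵥ x) 2 π := memLp_dotProduct hLp w
  have hwc : MemLp (fun x => w ⬝ᵥ x + c) 2 π := hw.add (memLp_const c)
  have he : MemLp (fun e : ℝ => e) 2 N := memLp_id_gaussianReal 2
  have hwc' : MemLp (fun q : (Fin d → ℝ) × ℝ => w ⬝ᵥ q.1 + c) 2 (π.prod N) := hwc.comp_fst N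
  have he' : MemLp (fun q : (Fin d → ℝ) × ℝ => q.2) 2 (π.prod N) := he.comp_snd π
  have hY : MemLp (fun q : (Fin d → ℝ) × ℝ => w ⬝ᵥ q.1 + c + q.2) 2 (π.prod N) := hwc'.add he'
  have hfst : (π.prod N).map Prod.fst = π := Measure.fst_prod
  have hfst' : (gaussianLinearModel m S w c v).map Prod.fst = π := fst_gaussianLinearModel m S w c v
  refine ⟨inferInstance, fun i => ?_, ?_, fun i => ?_, ?_, fun i j => ?_, ?_, fun i => ?_⟩
  · have := hLp i
    rw [← hπ, ← hfst'] at this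
    exact this.comp_of_map measurable_fst.aemeasurable
  · rw [gaussianLinearModel, memLp_map_measure_iff (by fun_prop) hT.aemeasurable]
    exact hY
  · rw [← integral_gaussianVector m S i, ← hπ, ← hfst',
      integral_map (by fun_prop) (aestronglyMeasurable_coord i)]
  · rw [gaussianLinearModel, integral_map hT.aemeasurable (by fun_prop),
      integral_add (hwc'.integrable one_le_two) (he'.integrable one_le_two),
      integral_fun_fst (fun x => w ⬝ᵥ x + c), integral_fun_snd (fun e : ℝ => e),
      integral_add (hw.integrable one_le_two) (integrable_const c),
      integral_dotProduct hLp (integral_gaussianVector m S), integral_id_gaussianReal, ← hmean]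
    simp
  · rw [← hcov i j, ← hπ, ← hfst',
      covariance_map_fun (aestronglyMeasurable_coord i)
        (aestronglyMeasurable_coord j) (by fun_prop)]
  · rw [gaussianLinearModel, variance_map (by fun_prop) hT.aemeasurable]
    simp only [Function.comp_def]
    rw [variance_add_prod hwc he, variance_add_const hw.aestronglyMeasurable,
      variance_dotProduct hLp hcov, variance_fun_id_gaussianReal, Real.coe_toNNReal _ hv, hvar]
  · rw [gaussianLinearModel, covariance_map_fun (by fun_prop) (by fun_prop) hT.aemeasurable]
    simp only
    have hXi : MemLp (fun q : (Fin d → ℝ) × ℝ => q.1 i) 2 (π.prod N) := (hLp i).comp_fst N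
    have hsplit : cov[fun q : (Fin d → ℝ) × ℝ => q.1 i, fun q => w ⬝ᵥ q.1 + c + q.2; π.prod N] =
        cov[fun q => q.1 i, fun q => w ⬝ᵥ q.1 + c; π.prod N] +
          cov[fun q => q.1 i, fun q => q.2; π.prod N] := covariance_add_right hXi hwc' he'
    have hx : cov[fun q : (Fin d → ℝ) × ℝ => q.1 i, fun q => w ⬝ᵥ q.1 + c; π.prod N] =
        cov[fun x => x i, fun x => w ⬝ᵥ x + c; π] := by
      conv_rhs => rw [← hfst]
      rw [covariance_map_fun (aestronglyMeasurable_coord i)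
        (by fun_prop) (by fun_prop)]
    rw [hsplit, hx, covariance_fst_snd_prod (hLp i) he, add_zero,
      covariance_add_const_right (hw.integrable one_le_two), covariance_comm,
      covariance_dotProduct_left hLp (hLp i) (C := fun j => S i j)
        (fun j => by rw [covariance_comm, hcov]), dotProduct_comm, ← hC]
    rfl

/-- In the Gaussian linear model the noise is independent of the input and hence of the estimate,
so the risk splits into the noise variance and the squared distance of the estimate to the
regression function. -/
lemma risk_gaussianLinearModel (hv : 0 ≤ v) (κ : Kernel (Fin d → ℝ) ℝ) [IsMarkovKernel κ] :
    risk sqLoss κ (gaussianLinearModel m S w c v) =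
      ENNReal.ofReal v +
        ∫⁻ p, ENNReal.ofReal ((w ⬝ᵥ p.1 + c - p.2) ^ 2) ∂(gaussianVector m S ⊗ₘ κ) := by
  set π := gaussianVector m S
  have hm : Measurable fun p : ((Fin d → ℝ) × ℝ) × ℝ => ENNReal.ofReal ((p.1.2 - p.2) ^ 2) := by
    fun_prop
  have hm' : Measurable fun p : (Fin d → ℝ) × ℝ =>
      ∫⁻ z, ENNReal.ofReal ((p.2 - z) ^ 2) ∂(κ p.1) :=
    hm.lintegral_kernel_prod_right' (κ := κ.prodMkRight ℝ)
  have hm'' : Measurable fun q : (Fin d → ℝ) × ℝ =>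
      ∫⁻ z, ENNReal.ofReal ((w ⬝ᵥ q.1 + c + q.2 - z) ^ 2) ∂(κ q.1) :=
    hm'.comp (measurable_linearModel w c)
  have hinner : ∀ x : Fin d → ℝ, ∀ z : ℝ,
      ∫⁻ e, ENNReal.ofReal ((w ⬝ᵥ x + c + e - z) ^ 2) ∂(gaussianReal 0 v.toNNReal) =
        ENNReal.ofReal ((w ⬝ᵥ x + c - z) ^ 2) + ENNReal.ofReal v := by
    intro x z
    have h := lintegral_ofReal_sub_sq_gaussianReal 0 (z - (w ⬝ᵥ x + c)) hv
    rw [ENNReal.ofReal_add (sq_nonneg _) hv] at h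
    convert h using 4 with e <;> ring
  rw [risk_sqLoss_eq, gaussianLinearModel,
    lintegral_map hm' (measurable_linearModel w c),
    lintegral_prod _ hm''.aemeasurable,
    Measure.lintegral_compProd (by fun_prop)]
  have hswap : ∀ x : Fin d → ℝ,
      ∫⁻ e, ∫⁻ z, ENNReal.ofReal ((w ⬝ᵥ x + c + e - z) ^ 2) ∂(κ x) ∂(gaussianReal 0 v.toNNReal) =
        ENNReal.ofReal v + ∫⁻ z, ENNReal.ofReal ((w ⬝ᵥ x + c - z) ^ 2) ∂(κ x) := by
    intro x
    rw [lintegral_lintegral_swap (by fun_prop)]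
    simp_rw [hinner]
    rw [lintegral_add_right _ measurable_const, lintegral_const, measure_univ, mul_one, add_comm]
  simp_rw [hswap]
  rw [lintegral_add_left measurable_const, lintegral_const, measure_univ, mul_one]

/-- The rate-distortion lower bound for a Gaussian input: with `s` the variance of the regression
function, every estimate pays at least as much as along the backward channel of distortion
`D ≤ s`, whose likelihood ratio is the test function in Gibbs' variational bound. -/
lemma le_riskInfoCost_gaussianLinearModel (hS : S.PosSemidef) (hv : 0 ≤ v) {lam : ℝ}
    (hlam : 0 < lam) {s D : ℝ} (hs : w ⬝ᵥ S *ᵥ w = s) (hD : 0 < D) (hDs : D ≤ s)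
    (hDlam : 2 * D ≤ lam * Real.logb 2 (Real.exp 1)) (κ : Kernel (Fin d → ℝ) ℝ)
    [IsMarkovKernel κ] :
    ENNReal.ofReal (v + D * Real.log (s / D) + D) ≤
      riskInfoCost sqLoss lam κ (gaussianLinearModel m S w c v) := by
  have hs0 : 0 < s := hD.trans_le hDs
  set π := gaussianVector m S with hπ
  have hlaw : π.map (fun x => w ⬝ᵥ x + c) = gaussianReal (w ⬝ᵥ m + c) s.toNNReal := by
    rw [hπ, map_gaussianVector_affine m hS, hs]
  rw [riskInfoCost, ofReal_mul_mutualInfo _ hlam, risk_gaussianLinearModel m S w c v hv,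
    fst_gaussianLinearModel, ← hπ, Measure.fst_compProd]
  set ρ := π ⊗ₘ κ with hρ
  set E := ∫⁻ p, ENNReal.ofReal ((w ⬝ᵥ p.1 + c - p.2) ^ 2) ∂ρ with hE
  rcases eq_or_ne E ∞ with htop | hfin
  · simp [htop]
  set f : (Fin d → ℝ) × ℝ → ℝ :=
    fun p => gaussianLogRatio p.2 D (w ⬝ᵥ m + c) s (w ⬝ᵥ p.1 + c) with hf
  have hfm : Measurable f :=
    measurable_gaussianLogRatio measurable_snd measurable_const (by fun_prop) _ _
  -- For each output the likelihood ratio integrates to one over the input.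
  have hexp : ∫⁻ p, ENNReal.ofReal (Real.exp (f p)) ∂(π.prod ρ.snd) = 1 := by
    rw [lintegral_prod_symm' _ hfm.exp.ennreal_ofReal]
    have hone : ∀ z, ∫⁻ x, ENNReal.ofReal (Real.exp (f (x, z))) ∂π = 1 := by
      intro z
      have hm : Measurable fun t => ENNReal.ofReal
          (Real.exp (gaussianLogRatio z D (w ⬝ᵥ m + c) s t)) :=
        (measurable_gaussianLogRatio measurable_const measurable_const measurable_id _
          _).exp.ennreal_ofReal
      rw [← lintegral_exp_gaussianLogRatio z (w ⬝ᵥ m + c) hD hs0, ← hlaw,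
        lintegral_map hm (by fun_prop)]
    simp [hone]
  have hE₂ : ∫⁻ p, ENNReal.ofReal ((w ⬝ᵥ p.1 + c - (w ⬝ᵥ m + c)) ^ 2) ∂ρ = ENNReal.ofReal s := by
    have h := lintegral_ofReal_sub_sq_gaussianReal (w ⬝ᵥ m + c) (w ⬝ᵥ m + c) hs0.le
    rw [← hlaw, lintegral_map (by fun_prop) (by fun_prop), sub_self, zero_pow two_ne_zero,
      zero_add] at h
    rw [← h, hρ, Measure.lintegral_compProd (by fun_prop)]
    simp
  obtain ⟨hint, hval⟩ := integral_gaussianLogRatio (μ := ρ) (g := fun p => w ⬝ᵥ p.1 + c)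
    measurable_snd measurable_const (by fun_prop) D s ENNReal.toReal_nonneg hs0.le
    (ENNReal.ofReal_toReal hfin).symm hE₂
  have hgibbs := ofReal_integral_le_klDiv hfm hint hexp
  rw [hf, hval] at hgibbs
  calc ENNReal.ofReal (v + D * Real.log (s / D) + D)
      = ENNReal.ofReal (v + E.toReal + 2 * D *
          (1 / 2 * Real.log (s / D) - E.toReal / (2 * D) + s / (2 * s))) := by
        congr 1
        field_simp
        ring
    _ ≤ ENNReal.ofReal v + ENNReal.ofReal E.toReal + ENNReal.ofReal (2 * D) *
          ENNReal.ofReal (1 / 2 * Real.log (s / D) - E.toReal / (2 * D) + s / (2 * s)) := by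
        rw [← ENNReal.ofReal_mul (by positivity)]
        exact ENNReal.ofReal_add_le.trans (add_le_add_left ENNReal.ofReal_add_le _)
    _ ≤ _ := by
        rw [ENNReal.ofReal_toReal hfin]
        gcongr

end GaussianLinearModel

/-! ### The saddle point -/

/-- A uniform upper bound on the cost of one estimate and an equal lower bound on the cost of all
estimates under one law in `Γ` form a saddle point, and all the values in question coincide. -/
lemma saddlePoint_values {𝓧 𝓨 𝓩 : Type*} [MeasurableSpace 𝓧] [MeasurableSpace 𝓨]
    [MeasurableSpace 𝓩] (l : 𝓩 → 𝓨 → ℝ≥0∞) (lam : ℝ) {Γ : Set (Measure (𝓧 × 𝓨))}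
    {κ : Kernel 𝓧 𝓩} (hκ : IsMarkovKernel κ) {P : Measure (𝓧 × 𝓨)} (hP : P ∈ Γ) {V : ℝ≥0∞}
    (hupper : ∀ Q ∈ Γ, riskInfoCost l lam κ Q ≤ V)
    (hlower : ∀ η : Kernel 𝓧 𝓩, IsMarkovKernel η → V ≤ riskInfoCost l lam η P) :
    minimaxCost (𝓩 := 𝓩) l lam Γ = V ∧ worstCaseCost l lam Γ κ = V ∧
      (∀ Q ∈ Γ, minimalCost (𝓩 := 𝓩) l lam Q ≤ V) ∧ minimalCost (𝓩 := 𝓩) l lam P = V ∧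
      riskInfoCost l lam κ P = V := by
  have hworst : worstCaseCost l lam Γ κ ≤ V := iSup₂_le hupper
  have hminle : ∀ Q ∈ Γ, minimalCost (𝓩 := 𝓩) l lam Q ≤ V := fun Q hQ =>
    (iInf₂_le κ hκ).trans (hupper Q hQ)
  have hV : V ≤ minimalCost (𝓩 := 𝓩) l lam P := le_iInf₂ hlower
  have hmm : V ≤ minimaxCost (𝓩 := 𝓩) l lam Γ := le_iInf₂ fun η hη =>
    (hlower η hη).trans (le_iSup₂ (f := fun Q _ => riskInfoCost l lam η Q) P hP)
  have hmw : minimaxCost (𝓩 := 𝓩) l lam Γ ≤ worstCaseCost l lam Γ κ := iInf₂_le κ hκ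
  exact ⟨le_antisymm (hmw.trans hworst) hmm, le_antisymm hworst (hmm.trans hmw), hminle,
    le_antisymm (hminle P hP) hV, le_antisymm (hupper P hP) (hlower κ hκ)⟩

theorem proposition2 (d : ℕ) (muX : Fin d → ℝ) (muY : ℝ) (S : Matrix (Fin d) (Fin d) ℝ)
    (σY : ℝ) (C : Fin d → ℝ) (lam : ℝ) (hlam : 0 < lam)
    (hS : IsUnit S.det) (hΓ : (momentSet muX muY S σY C).Nonempty)
    (s : ℝ) (hs : s = C ⬝ᵥ (S⁻¹ *ᵥ C))
    (loge : ℝ) (hloge : loge = Real.logb 2 (Real.exp 1))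
    (a : ℝ) (ha : a = 1 - lam * loge / (2 * s))
    (b : ℝ) (hb : b = muY - a * (C ᵥ* S⁻¹ ⬝ᵥ muX))
    (varZ : ℝ) (hvarZ : varZ = lam * a * loge / 2)
    (Yhat : Kernel (Fin d → ℝ) ℝ)
    (hYhat : Yhat = if lam * loge / 2 < s then noisyLinearEstimate a (C ᵥ* S⁻¹) b varZ
      else constEstimate muY) :
    -- the minimax risk-information cost
    (minimaxCost sqLoss lam (momentSet muX muY S σY C) : EReal) =
      ((if lam * loge / 2 < s then
          σY ^ 2 - s + lam / 2 * Real.logb 2 (2 * Real.exp 1 * s / (lam * loge))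
        else σY ^ 2 : ℝ) : EReal) ∧
    -- the estimate attains the infimum
    IsMarkovKernel Yhat ∧
    worstCaseCost sqLoss lam (momentSet muX muY S σY C) Yhat =
      minimaxCost sqLoss lam (momentSet muX muY S σY C) ∧
    -- a worst-case distribution is Gaussian, and the estimate is optimal for it
    ∃ P ∈ momentSet muX muY S σY C, IsGaussian P ∧
      (∀ Q ∈ momentSet muX muY S σY C,
        minimalCost (𝓩 := ℝ) sqLoss lam Q ≤ minimalCost (𝓩 := ℝ) sqLoss lam P) ∧
      minimalCost (𝓩 := ℝ) sqLoss lam P =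
        minimaxCost (𝓩 := ℝ) sqLoss lam (momentSet muX muY S σY C) ∧
      riskInfoCost sqLoss lam Yhat P = minimalCost (𝓩 := ℝ) sqLoss lam P := by
  obtain ⟨P₀, hP₀⟩ := hΓ
  have hP₀ : HasMoments muX muY S σY C P₀ := hP₀
  have hs0 : 0 ≤ s := hs ▸ regression_nonneg hS hP₀
  have hsσ : s ≤ σY ^ 2 := hs ▸ regression_le hS hP₀
  have hpsd := posSemidef_of_hasMoments hP₀
  have hsymm : Sᵀ = S := by simpa [IsHermitian, conjTranspose_eq_transpose_of_trivial] using hpsd.1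
  have hlog2 : 0 < Real.log 2 := Real.log_pos one_lt_two
  have hloge' : loge = 1 / Real.log 2 := by rw [hloge, Real.logb, Real.log_exp]
  have hloge0 : 0 < loge := by rw [hloge']; positivity
  set w := C ᵥ* S⁻¹ with hw
  have hws : w ⬝ᵥ S *ᵥ w = s := by rw [hs, hw, regression_quadratic hS]
  have hSw : S *ᵥ w = C := by
    conv_lhs => rw [← hsymm]
    rw [mulVec_transpose, hw, vecMul_vecMul, nonsing_inv_mul _ hS, vecMul_one]
  set P := gaussianLinearModel muX S w (muY - w ⬝ᵥ muX) (σY ^ 2 - s) with hPdef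
  have hP : P ∈ momentSet muX muY S σY C :=
    hasMoments_gaussianLinearModel muX S w _ _ hpsd (sub_nonneg.2 hsσ) (by ring)
      (by rw [hws]; ring) hSw
  set V : ℝ := if lam * loge / 2 < s then
      σY ^ 2 - s + lam / 2 * Real.logb 2 (2 * Real.exp 1 * s / (lam * loge))
    else σY ^ 2 with hVdef
  -- `D` is the distortion at which the rate-distortion slope matches the price of information.
  set D := lam * loge / 2 with hD
  have hD0 : 0 < D := by positivity
  have hVlog : D < s → V = (σY ^ 2 - s) + D * Real.log (s / D) + D := by
    intro h
    have hspos : 0 < s := hD0.trans h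
    have harg : 2 * Real.exp 1 * s / (lam * loge) = Real.exp 1 * (s / D) := by
      rw [hD]
      field_simp
    rw [hVdef, if_pos h, harg, Real.logb,
      Real.log_mul (Real.exp_pos 1).ne' (div_pos hspos hD0).ne', Real.log_exp, hD, hloge']
    field_simp
    ring
  have hV0 : 0 ≤ V := by
    by_cases h : D < s
    · rw [hVlog h]
      have : 0 ≤ Real.log (s / D) := Real.log_nonneg ((one_le_div hD0).2 h.le)
      have : 0 ≤ σY ^ 2 - s := sub_nonneg.2 hsσ
      positivity
    · rw [hVdef, if_neg h]
      positivity
  have hmarkov : IsMarkovKernel Yhat := by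
    rw [hYhat]
    split_ifs <;> infer_instance
  have hupper : ∀ Q ∈ momentSet muX muY S σY C,
      riskInfoCost sqLoss lam Yhat Q ≤ ENNReal.ofReal V := by
    intro Q hQ
    have hQ : HasMoments muX muY S σY C Q := hQ
    by_cases h : D < s
    · have hspos : 0 < s := hD0.trans h
      have ha' : a = 1 - D / s := by rw [ha, hD]; field_simp
      have ha0 : 0 < a := by
        rw [ha', sub_pos]
        exact (div_lt_one hspos).2 h
      have hvar' : varZ = a * D := by rw [hvarZ, hD]; ring
      have hvar0 : 0 < varZ := by rw [hvar']; positivity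
      have has : a * s = s - D := by rw [ha']; field_simp
      have hcost := riskInfoCost_noisyLinearEstimate_le hS hQ hlam a hvar0
      rw [hYhat, if_pos h, hb]
      refine hcost.trans_eq ?_
      -- The output variance `a² s + varZ` equals `a s`, and the risk equals `σY² - s + D`.
      have hout : a ^ 2 * s + varZ = a * s := by
        rw [hvar']
        linear_combination a * has
      have hratio : a * s / varZ = s / D := by
        rw [hvar', mul_div_mul_left _ _ ha0.ne']
      have hrisk : a ^ 2 * s - 2 * a * s + σY ^ 2 + varZ = σY ^ 2 - s + D := by
        linear_combination hout - has
      have hlog : 0 ≤ Real.log (s / D) := Real.log_nonneg ((one_le_div hD0).2 h.le)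
      rw [← hs, hout, hratio, hrisk, ← hloge, ← ENNReal.ofReal_mul (by positivity),
        ← ENNReal.ofReal_add (add_nonneg (sub_nonneg.2 hsσ) hD0.le) (by positivity), hVlog h]
      congr 1
      rw [hD]
      ring
    · rw [hYhat, if_neg h, riskInfoCost_constEstimate hQ, hVdef, if_neg h]
  have hlower : ∀ η : Kernel (Fin d → ℝ) ℝ, IsMarkovKernel η →
      ENNReal.ofReal V ≤ riskInfoCost sqLoss lam η P := by
    intro η _
    have hbound : ∀ D', 0 < D' → D' ≤ s → D' ≤ D →
        ENNReal.ofReal (σY ^ 2 - s + D' * Real.log (s / D') + D') ≤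
          riskInfoCost sqLoss lam η P := fun D' h0 h1 h2 =>
      le_riskInfoCost_gaussianLinearModel muX S w _ _ hpsd (sub_nonneg.2 hsσ) hlam hws h0 h1
        (by rw [← hloge]; linarith) η
    by_cases h : D < s
    · rw [hVlog h]
      exact hbound D hD0 h.le le_rfl
    · rw [hVdef, if_neg h]
      rcases hs0.eq_or_lt with hzero | hpos
      · -- For `s = 0` the whole variance of `Y` is noise.
        rw [riskInfoCost, hPdef, risk_gaussianLinearModel muX S w _ _ (sub_nonneg.2 hsσ),
          ← hzero, sub_zero, add_assoc]
        exact le_self_add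
      · have hb := hbound s hpos le_rfl (not_lt.1 h)
        rw [div_self hpos.ne', Real.log_one, mul_zero, add_zero, sub_add_cancel] at hb
        exact hb
  obtain ⟨h1, h2, h3, h4, h5⟩ := saddlePoint_values sqLoss lam hmarkov hP hupper hlower
  refine ⟨?_, hmarkov, h2.trans h1.symm, P, hP, isGaussian_gaussianLinearModel _ _ _ _ _,
    fun Q hQ => (h3 Q hQ).trans_eq h4.symm, h4.trans h1.symm, h5.trans h4.symm⟩
  rw [h1, EReal.coe_ennreal_ofReal, max_eq_left hV0]
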